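/- Let $G$ be a compact group with normalized Haar measure $\mathrm{d}g$, let $\mathfrak{A}$ be a separable (not necessarily unital) $C^*$-algebra, and let $\alpha: G\to\mathrm{Aut}(\mathfrak{A})$ be a group homomorphism such that $g\mapsto\alpha_g(a)$ is norm continuous for every $a\in\mathfrak{A}$. For a state $\omega$ on $\mathfrak{A}$ let $(\mathcal{H}_\omega,\pi_\omega)$ be its GNS representation and put $\mathcal{R}_\omega:=\pi_\omega(\mathfrak{A})''$. Assume that $\omega$ is $G$-quasi-invariant, that is, for every $g\in G$ the representations $\pi_{\omega\circ\alpha_g}$ and $\pi_\omega$ are unitarily equivalent. Then for every $g\in G$ there is a unitary $V_g$ on $\mathcal{H}_\omega$ with $V_g\pi_\omega(a)V_g^*=\pi_\omega(\alpha_g(a))$ for all $a\in\mathfrak{A}$, and $\widetilde{\alpha}_g(T):=V_gTV_g^*$ $(T\in\mathcal{R}_\omega)$ does not depend on the choice of $V_g$ and defines an action $\widetilde{\alpha}$ of $G$ on $\mathcal{R}_\omega$ by $*$-automorphisms, with $\widetilde{\alpha}_g(\pi_\omega(a))=\pi_\omega(\alpha_g(a))$ for all $g\in G$ and $a\in\mathfrak{A}$;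 this is the lift of the action of $G$ to $\mathcal{R}_\omega$. **Lemma.** For all $T\in\mathcal{R}_\omega$ and $x\in\mathcal{H}_\omega$ the function $G\ni g\mapsto\widetilde{\alpha}_g(T)x\in\mathcal{H}_\omega$ is Bochner integrable. For $T\in\mathcal{R}_\omega$, the formula $$\widetilde{E}_G[T]x:=\int_G\widetilde{\alpha}_g(T)x\,\mathrm{d}g,\qquad x\in\mathcal{H}_\omega,$$ defines an operator $\widetilde{E}_G[T]\in\mathcal{R}_\omega$, and the linear map $\widetilde{E}_G:\mathcal{R}_\omega\to\mathcal{R}_\omega$ is faithful and normal: if $T\in\mathcal{R}_\omega$ and $\widetilde{E}_G[T^*T]=0$, then $T=0$; and $\varphi\circ\widetilde{E}_G$ is a normal state for every normal state $\varphi$ on $\mathcal{R}_\omega$. Here a state $\varphi$ on $\mathcal{R}_\omega$ is called normal if $\varphi(\sup_iT_i)=\sup_i\varphi(T_i)$ for every bounded increasing net $(T_i)$ of positive elements of $\mathcal{R}_\omega$. -/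

import Mathlib

open scoped ComplexOrder
open MeasureTheory

namespace QuasiInv

section Representations

variable {A : Type*} [NonUnitalCStarAlgebra A]
variable {H : Type*} [NormedAddCommGroup H] [InnerProductSpace ℂ H] [CompleteSpace H]
variable {K : Type*} [NormedAddCommGroup K] [InnerProductSpace ℂ K] [CompleteSpace K]

/-- Two representations of `A` on Hilbert spaces are unitarily equivalent if a surjective linear
isometry intertwines them. -/
def UnitarilyEquivalent (π : A →⋆ₙₐ[ℂ] (H →L[ℂ] H)) (ρ : A →⋆ₙₐ[ℂ] (K →L[ℂ] K)) : Prop :=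
  ∃ U : H ≃ₗᵢ[ℂ] K, ∀ (a : A) (x : H), U (π a x) = ρ a (U x)

/-- The von Neumann algebra `π(A)''` generated by a representation. -/
noncomputable def generatedVN (π : A →⋆ₙₐ[ℂ] (H →L[ℂ] H)) : VonNeumannAlgebra H where
  carrier := Set.centralizer (Set.centralizer (Set.range π))
  mul_mem' := Set.mul_mem_centralizer
  one_mem' := Set.one_mem_centralizer
  add_mem' := Set.add_mem_centralizer
  zero_mem' := Set.zero_mem_centralizer
  algebraMap_mem' c := by
    intro S _
    exact (Algebra.commutes c S).symm
  star_mem' := by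
    intro T hT S hS
    have hS' : star S ∈ Set.centralizer (Set.range π) := by
      rintro _ ⟨a, rfl⟩
      have := hS (π (star a)) ⟨_, rfl⟩
      have := congrArg star this
      simpa [← map_star] using this.symm
    have := congrArg star (hT _ hS')
    simpa using this.symm
  centralizer_centralizer' := by
    simp [Set.centralizer_centralizer_centralizer]

theorem mem_generatedVN {π : A →⋆ₙₐ[ℂ] (H →L[ℂ] H)} {T : H →L[ℂ] H} :
    T ∈ generatedVN π ↔ T ∈ Set.centralizer (Set.centralizer (Set.range π)) :=
  Iff.rfl

theorem apply_mem_generatedVN (π : A →⋆ₙₐ[ℂ] (H →L[ℂ] H)) (a : A) : π a ∈ generatedVN π :=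
  Set.subset_centralizer_centralizer ⟨a, rfl⟩

/-- A von Neumann algebra is closed under complex scalar multiplication; this provides the
vector space structure on its elements. -/
instance : SMulMemClass (VonNeumannAlgebra H) ℂ (H →L[ℂ] H) where
  smul_mem {S} c _ hT := S.toStarSubalgebra.smul_mem hT c

/-- `V T V*` belongs to `π(A)''` for `T` in `π(A)''`, if `V` implements an automorphism of `A`. -/
theorem conj_mem_generatedVN {π : A →⋆ₙₐ[ℂ] (H →L[ℂ] H)} {β : A ≃⋆ₐ[ℂ] A} {V : H ≃ₗᵢ[ℂ] H}
    (hV : ∀ a, V.conjStarAlgEquiv (π a) = π (β a)) {T : H →L[ℂ] H} (hT : T ∈ generatedVN π) :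
    V.conjStarAlgEquiv T ∈ generatedVN π := by
  intro S hS
  have hS' : V.conjStarAlgEquiv.symm S ∈ Set.centralizer (Set.range π) := by
    rintro _ ⟨a, rfl⟩
    apply V.conjStarAlgEquiv.injective
    change V.conjStarAlgEquiv (_ * _) = V.conjStarAlgEquiv (_ * _)
    rw [map_mul, map_mul, StarAlgEquiv.apply_symm_apply, hV]
    exact hS _ ⟨_, rfl⟩
  have := congrArg V.conjStarAlgEquiv (hT _ hS')
  rwa [map_mul, map_mul, StarAlgEquiv.apply_symm_apply] at this

/-- Two unitaries implementing the same automorphism of `A` induce the same map on `π(A)''`. -/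
theorem conj_eq_of_implements {π : A →⋆ₙₐ[ℂ] (H →L[ℂ] H)} {V W : H ≃ₗᵢ[ℂ] H}
    (h : ∀ a, V.conjStarAlgEquiv (π a) = W.conjStarAlgEquiv (π a))
    {T : H →L[ℂ] H} (hT : T ∈ generatedVN π) :
    V.conjStarAlgEquiv T = W.conjStarAlgEquiv T := by
  set X : H →L[ℂ] H := ((V.trans W.symm).toContinuousLinearEquiv : H →L[ℂ] H) with hX
  have hXc : X ∈ Set.centralizer (Set.range π) := by
    rintro _ ⟨a, rfl⟩
    ext x
    have := congrArg (fun S : H →L[ℂ] H => W.symm (S (V x))) (h a)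
    simpa [hX] using this.symm
  have h1 := hT X hXc
  ext x
  have := congrArg (fun S : H →L[ℂ] H => W (S (V.symm x))) h1
  simpa [hX] using this

end Representations

section GNS

variable {A : Type*} [NonUnitalCStarAlgebra A] [PartialOrder A] [StarOrderedRing A]

/-- A state of a (not necessarily unital) C⋆-algebra: a positive linear functional of norm one. -/
def IsState (ω : A →ₚ[ℂ] ℂ) : Prop :=
  ‖(⟨ω.toLinearMap, map_continuous ω⟩ : A →L[ℂ] ℂ)‖ = 1

/-- The positive functional `ω ∘ β`, for an automorphism `β`. -/
def compAut (ω : A →ₚ[ℂ] ℂ) (β : A ≃⋆ₐ[ℂ] A) : A →ₚ[ℂ] ℂ :=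
  ω.comp (PositiveLinearMap.ofClass β)

@[simp]
theorem compAut_apply (ω : A →ₚ[ℂ] ℂ) (β : A ≃⋆ₐ[ℂ] A) (a : A) : compAut ω β a = ω (β a) :=
  rfl

/-- The canonical embedding of `A` in the GNS space of `ω`. -/
noncomputable def toGNS (ω : A →ₚ[ℂ] ℂ) : A →ₗ[ℂ] ω.GNS :=
  (UniformSpace.Completion.toComplL (𝕜 := ℂ) (E := ω.PreGNS)).toLinearMap ∘ₗ
    ω.toPreGNS.toLinearMap

theorem denseRange_toGNS (ω : A →ₚ[ℂ] ℂ) : DenseRange (toGNS ω) :=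
  (UniformSpace.Completion.denseRange_coe (α := ω.PreGNS)).comp
    ω.toPreGNS.surjective.denseRange (UniformSpace.Completion.continuous_coe _)

theorem norm_toGNS (ω : A →ₚ[ℂ] ℂ) (a : A) : ‖toGNS ω a‖ = √(ω (star a * a)).re := by
  change ‖((ω.toPreGNS a : ω.PreGNS) : ω.GNS)‖ = _
  rw [UniformSpace.Completion.norm_coe, PositiveLinearMap.preGNS_norm_def]
  simp

theorem gns_toGNS (ω : A →ₚ[ℂ] ℂ) (a b : A) :
    ω.gnsNonUnitalStarAlgHom a (toGNS ω b) = toGNS ω (a * b) := by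
  change ω.gnsNonUnitalStarAlgHom a ((ω.toPreGNS b : ω.PreGNS) : ω.GNS) = _
  rw [PositiveLinearMap.gnsNonUnitalStarAlgHom_apply_coe]
  simp [toGNS]

/-- The canonical unitary from the GNS space of `ω ∘ β` onto that of `ω`, `[a] ↦ [β a]`. -/
noncomputable def gnsCompAut (ω : A →ₚ[ℂ] ℂ) (β : A ≃⋆ₐ[ℂ] A) : (compAut ω β).GNS ≃ₗᵢ[ℂ] ω.GNS :=
  LinearEquiv.extendOfIsometry
    (LinearEquiv.mk (R := ℂ) (S := ℂ) (σ := RingHom.id ℂ)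
      { toFun := β, map_add' := map_add β, map_smul' := map_smul β }
      β.symm β.symm_apply_apply β.apply_symm_apply)
    (toGNS (compAut ω β)) (toGNS ω) (denseRange_toGNS _) (denseRange_toGNS _) (fun a => by
      change ‖toGNS ω (β a)‖ = _
      rw [norm_toGNS, norm_toGNS, compAut_apply, map_mul β, map_star β])

theorem gnsCompAut_intertwines (ω : A →ₚ[ℂ] ℂ) (β : A ≃⋆ₐ[ℂ] A) (a : A) (x : (compAut ω β).GNS) :
    gnsCompAut ω β ((compAut ω β).gnsNonUnitalStarAlgHom a x) =
      ω.gnsNonUnitalStarAlgHom (β a) (gnsCompAut ω β x) := by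
  have key : ∀ b, gnsCompAut ω β (toGNS (compAut ω β) b) = toGNS ω (β b) := fun b =>
    LinearEquiv.extendOfIsometry_eq _ _ _ _ _ _ b
  refine (denseRange_toGNS (compAut ω β)).induction_on x
    (isClosed_eq (by fun_prop) (by fun_prop)) fun b => ?_
  rw [gns_toGNS, key, key, gns_toGNS, map_mul]

/-- The von Neumann algebra `π_ω(A)''`, acting on the GNS space of `ω`. -/
noncomputable abbrev gnsVN (ω : A →ₚ[ℂ] ℂ) : VonNeumannAlgebra ω.GNS :=
  generatedVN ω.gnsNonUnitalStarAlgHom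

end GNS

section Action

variable {A : Type*} [NonUnitalCStarAlgebra A] [PartialOrder A] [StarOrderedRing A]
variable {G : Type*} [Group G]

/-- `ω` is quasi-invariant under the action `α` if, for every `g`, the GNS representations of
`ω ∘ α_g` and of `ω` are unitarily equivalent. -/
def IsQuasiInvariant (α : G →* (A ≃⋆ₐ[ℂ] A)) (ω : A →ₚ[ℂ] ℂ) : Prop :=
  ∀ g : G, UnitarilyEquivalent (compAut ω (α g)).gnsNonUnitalStarAlgHom ω.gnsNonUnitalStarAlgHom

variable {α : G →* (A ≃⋆ₐ[ℂ] A)} {ω : A →ₚ[ℂ] ℂ}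

theorem IsQuasiInvariant.exists_implementing (h : IsQuasiInvariant α ω) (g : G) :
    ∃ V : ω.GNS ≃ₗᵢ[ℂ] ω.GNS, ∀ a : A,
      V.conjStarAlgEquiv (ω.gnsNonUnitalStarAlgHom a) = ω.gnsNonUnitalStarAlgHom (α g a) := by
  obtain ⟨U, hU⟩ := h g
  refine ⟨U.symm.trans (gnsCompAut ω (α g)), fun a => ?_⟩
  ext x
  obtain ⟨y, rfl⟩ := (U.symm.trans (gnsCompAut ω (α g))).surjective x
  obtain ⟨z, rfl⟩ := U.surjective y
  simp [← hU, gnsCompAut_intertwines]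

/-- A unitary of the GNS space that implements `α_g`. It is not unique, but its adjoint action on
`π_ω(A)''` does not depend on the choice (`conj_eq_of_implements`). -/
noncomputable def implementing (h : IsQuasiInvariant α ω) (g : G) : ω.GNS ≃ₗᵢ[ℂ] ω.GNS :=
  (h.exists_implementing g).choose

theorem implementing_spec (h : IsQuasiInvariant α ω) (g : G) (a : A) :
    (implementing h g).conjStarAlgEquiv (ω.gnsNonUnitalStarAlgHom a) =
      ω.gnsNonUnitalStarAlgHom (α g a) :=
  (h.exists_implementing g).choose_spec a

theorem implementing_mem (h : IsQuasiInvariant α ω) (g : G) {T : ω.GNS →L[ℂ] ω.GNS}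
    (hT : T ∈ gnsVN ω) : (implementing h g).conjStarAlgEquiv T ∈ gnsVN ω :=
  conj_mem_generatedVN (implementing_spec h g) hT

theorem implementing_one (h : IsQuasiInvariant α ω) {T : ω.GNS →L[ℂ] ω.GNS}
    (hT : T ∈ gnsVN ω) : (implementing h 1).conjStarAlgEquiv T = T := by
  have := conj_eq_of_implements (V := implementing h 1) (W := LinearIsometryEquiv.refl ℂ ω.GNS)
    (fun a => by rw [implementing_spec]; simp) hT
  simpa using this

theorem implementing_mul (h : IsQuasiInvariant α ω) (g k : G) {T : ω.GNS →L[ℂ] ω.GNS}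
    (hT : T ∈ gnsVN ω) : (implementing h (g * k)).conjStarAlgEquiv T =
      (implementing h g).conjStarAlgEquiv ((implementing h k).conjStarAlgEquiv T) := by
  have := conj_eq_of_implements (V := implementing h (g * k))
    (W := (implementing h k).trans (implementing h g))
    (fun a => by
      rw [LinearIsometryEquiv.conjStarAlgEquiv_trans, StarAlgEquiv.trans_apply]
      simp only [implementing_spec, map_mul, StarAlgEquiv.mul_apply]) hT
  rw [this, LinearIsometryEquiv.conjStarAlgEquiv_trans, StarAlgEquiv.trans_apply]

/-- The lift of the action of `G` to the von Neumann algebra `π_ω(A)''`: the automorphism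
attached to `g` is `T ↦ V T V*`, for any unitary `V` on the GNS space that implements `α_g`. -/
noncomputable def liftedAction (h : IsQuasiInvariant α ω) : G →* (gnsVN ω ≃⋆ₐ[ℂ] gnsVN ω) where
  toFun g :=
    { toFun := fun T => ⟨(implementing h g).conjStarAlgEquiv T, implementing_mem h g T.2⟩
      invFun := fun T => ⟨(implementing h g⁻¹).conjStarAlgEquiv T, implementing_mem h g⁻¹ T.2⟩
      left_inv := fun T => Subtype.ext (by
        change (implementing h g⁻¹).conjStarAlgEquiv ((implementing h g).conjStarAlgEquiv T) = T
        rw [← implementing_mul h _ _ T.2, inv_mul_cancel, implementing_one h T.2])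
      right_inv := fun T => Subtype.ext (by
        change (implementing h g).conjStarAlgEquiv ((implementing h g⁻¹).conjStarAlgEquiv T) = T
        rw [← implementing_mul h _ _ T.2, mul_inv_cancel, implementing_one h T.2])
      map_mul' := fun S T => Subtype.ext (map_mul (implementing h g).conjStarAlgEquiv _ _)
      map_add' := fun S T => Subtype.ext (map_add (implementing h g).conjStarAlgEquiv _ _)
      map_star' := fun T => Subtype.ext (map_star (implementing h g).conjStarAlgEquiv _)
      map_smul' := fun c T => Subtype.ext (map_smul (implementing h g).conjStarAlgEquiv c _) }
  map_one' := StarAlgEquiv.ext fun T => Subtype.ext (implementing_one h T.2)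
  map_mul' g k := StarAlgEquiv.ext fun T => Subtype.ext (implementing_mul h g k T.2)

/-- The lifted action extends the action on `A`. -/
theorem liftedAction_gns (h : IsQuasiInvariant α ω) (g : G) (a : A) :
    liftedAction h g ⟨ω.gnsNonUnitalStarAlgHom a, apply_mem_generatedVN _ a⟩ =
      ⟨ω.gnsNonUnitalStarAlgHom (α g a), apply_mem_generatedVN _ _⟩ :=
  Subtype.ext (implementing_spec h g a)

/-- The lifted action is given by every unitary that implements `α_g`. -/
theorem coe_liftedAction_eq (h : IsQuasiInvariant α ω) (g : G) (V : ω.GNS ≃ₗᵢ[ℂ] ω.GNS)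
    (hV : ∀ a : A,
      V.conjStarAlgEquiv (ω.gnsNonUnitalStarAlgHom a) = ω.gnsNonUnitalStarAlgHom (α g a))
    (T : gnsVN ω) : (liftedAction h g T : ω.GNS →L[ℂ] ω.GNS) = V.conjStarAlgEquiv T :=
  conj_eq_of_implements (fun a => by rw [implementing_spec, hV]) T.2

end Action

section Normal

variable {H : Type*} [NormedAddCommGroup H] [InnerProductSpace ℂ H] [CompleteSpace H]

/-- A normal state on a von Neumann algebra: a positive linear functional `φ` with `φ 1 = 1` that
preserves suprema of bounded increasing nets of positive elements (the order is the usual order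
of operators, and a net is represented by its range, an upward directed set). -/
structure IsNormalState (R : VonNeumannAlgebra H) (φ : R →ₗ[ℂ] ℂ) : Prop where
  nonneg : ∀ T : R, 0 ≤ T → 0 ≤ φ T
  map_one : φ 1 = 1
  normal : ∀ (D : Set R) (T : R), D.Nonempty → DirectedOn (· ≤ ·) D → (∀ S ∈ D, 0 ≤ S) →
    IsLUB D T → IsLUB ((fun S => (φ S).re) '' D) (φ T).re

end Normal

end QuasiInv

/-! Write `α̃` for `liftedAction` and `V_g` for the chosen unitaries. Since `‖α̃_g(T)x‖ ≤ ‖T‖‖x‖`,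
integrability reduces to measurability. For `T = π(a)` the function `g ↦ π(α_g(a))x` is continuous.
Measurability passes only to limits of sequences, so a general `T` has to be reached from `π(A)` by
strongly convergent sequences. As `A`, hence the GNS space, is separable, a sequential Kaplansky
argument provides them: for selfadjoint `T` the bounded functions `T(1 + δ²T²)⁻¹` are such limits
(`exists_seq_tendsto_regularize`), they tend to `T` in norm as `δ → 0`, and real and imaginary parts
give the rest. For each fixed `g`, conjugation by `V_g` respects strong limits, so no regularity of
`g ↦ V_g` is needed.

The average stays in `π(A)''` because bounded operators pass under the integral. It is faithful
because `∫ ‖α̃_g(T)x‖² dg = 0` on a countable dense set of `x` forces `α̃_g(T) = 0` for almost every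
`g`, and a single such `g` suffices. It preserves suprema by dominated convergence, which needs
sequences: on a separable space the supremum of a bounded directed set is a strong limit of a
sequence in that set (`exists_seq_tendsto_of_isLUB`). -/

namespace QuasiInv

/-! ### Von Neumann density, also with selfadjoint approximants -/

section StrongApproximation

open Filter Topology

variable {A : Type*} [NonUnitalCStarAlgebra A]
variable {H : Type*} [NormedAddCommGroup H] [InnerProductSpace ℂ H]

/-- The diagonal action of an operator on a finite power of the Hilbert space. -/
noncomputable def diagonal (n : ℕ) (T : H →L[ℂ] H) :
    PiLp 2 (fun _ : Fin n => H) →L[ℂ] PiLp 2 (fun _ : Fin n => H) :=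
  ((PiLp.continuousLinearEquiv 2 ℂ (fun _ : Fin n => H)).symm :
      (Fin n → H) →L[ℂ] PiLp 2 (fun _ : Fin n => H)) ∘L
    ContinuousLinearMap.pi fun i => T ∘L PiLp.proj 2 (fun _ : Fin n => H) i

@[simp]
theorem diagonal_apply (n : ℕ) (T : H →L[ℂ] H) (v : PiLp 2 (fun _ : Fin n => H)) (i : Fin n) :
    diagonal n T v i = T (v i) :=
  rfl

variable [CompleteSpace H]

theorem inner_apply_eq_inner_star_apply (π : A →⋆ₙₐ[ℂ] (H →L[ℂ] H)) (a : A) (x y : H) :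
    inner ℂ (π a x) y = inner ℂ x (π (star a) y) := by
  rw [map_star, ContinuousLinearMap.star_eq_adjoint, ContinuousLinearMap.adjoint_inner_right]

/-- The orbit map `a ↦ (π(a) xᵢ)ᵢ` of a finite family of vectors. -/
noncomputable def orbitMap (π : A →⋆ₙₐ[ℂ] (H →L[ℂ] H)) {n : ℕ} (x : Fin n → H) :
    A →ₗ[ℂ] PiLp 2 (fun _ : Fin n => H) where
  toFun a := WithLp.toLp 2 fun i => π a (x i)
  map_add' a b := by ext i; simp
  map_smul' c a := by ext i; simp

@[simp]
theorem orbitMap_apply (π : A →⋆ₙₐ[ℂ] (H →L[ℂ] H)) {n : ℕ} (x : Fin n → H) (a : A) (i : Fin n) :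
    orbitMap π x a i = π a (x i) :=
  rfl

/-- A projection commutes with the diagonal action of `π` if its range is the closure of the
orbit of a finite family of vectors. -/
theorem starProjection_orbit_diagonal (π : A →⋆ₙₐ[ℂ] (H →L[ℂ] H)) {n : ℕ} (x : Fin n → H) (a : A)
    (v : PiLp 2 (fun _ : Fin n => H)) :
    (LinearMap.range (orbitMap π x)).topologicalClosure.starProjection (diagonal n (π a) v) =
      diagonal n (π a)
        ((LinearMap.range (orbitMap π x)).topologicalClosure.starProjection v) := by
  set M := (LinearMap.range (orbitMap π x)).topologicalClosure with hM
  have hinv : ∀ b : A, ∀ u ∈ M, diagonal n (π b) u ∈ M := by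
    intro b u hu
    have hmaps : Set.MapsTo (diagonal n (π b)) (LinearMap.range (orbitMap π x))
        (LinearMap.range (orbitMap π x)) := by
      rintro _ ⟨c, rfl⟩
      exact ⟨b * c, by ext i; simp⟩
    exact hmaps.closure (diagonal n (π b)).continuous hu
  -- The closed orbit is invariant under a selfadjoint family of operators, so its orthogonal
  -- complement is invariant too.
  refine Submodule.eq_starProjection_of_mem_orthogonal
    (hinv a _ (M.starProjection_apply_mem v)) ?_
  rw [← map_sub, Submodule.mem_orthogonal]
  intro u hu
  have h1 : inner ℂ u (diagonal n (π a) (v - M.starProjection v)) =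
      inner ℂ (diagonal n (π (star a)) u) (v - M.starProjection v) := by
    simp [PiLp.inner_apply, inner_apply_eq_inner_star_apply]
  rw [h1]
  exact (Submodule.mem_orthogonal _ _).1 (M.sub_starProjection_mem_orthogonal v) _
    (hinv (star a) u hu)

/-- The density part of von Neumann's bicommutant theorem, for finitely many vectors. -/
theorem diagonal_apply_mem_closure_orbit {π : A →⋆ₙₐ[ℂ] (H →L[ℂ] H)}
    (hπ : ∀ y, (∀ a, π a y = 0) → y = 0) {T : H →L[ℂ] H} (hT : T ∈ generatedVN π)
    {n : ℕ} (x : Fin n → H) :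
    diagonal n T (WithLp.toLp 2 x) ∈ (LinearMap.range (orbitMap π x)).topologicalClosure := by
  classical
  set M := (LinearMap.range (orbitMap π x)).topologicalClosure with hM
  have hP : ∀ a v, M.starProjection (diagonal n (π a) v) = diagonal n (π a) (M.starProjection v) :=
    starProjection_orbit_diagonal π x
  -- Without a unit in `A` it is not automatic that `x` lies in its closed orbit `M`. But `π(a)x`
  -- lies in `M`, so every `π(a)` kills the components of `x - Px`, and nondegeneracy makes them
  -- zero.
  have hxM : M.starProjection (WithLp.toLp 2 x) = WithLp.toLp 2 x := by
    ext i
    refine (sub_eq_zero.1 (hπ _ fun a => ?_)).symm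
    have h1 : M.starProjection (diagonal n (π a) (WithLp.toLp 2 x)) =
        diagonal n (π a) (WithLp.toLp 2 x) := by
      rw [Submodule.starProjection_eq_self_iff]
      exact Submodule.le_topologicalClosure _ ⟨a, by ext i; simp⟩
    have h2 := congrArg (fun v : PiLp 2 (fun _ : Fin n => H) => v i)
      ((hP a (WithLp.toLp 2 x)).symm.trans h1)
    simp only [diagonal_apply] at h2
    rw [map_sub, h2, sub_self]
  let incl (j : Fin n) : H →L[ℂ] PiLp 2 (fun _ : Fin n => H) :=
    ((PiLp.continuousLinearEquiv 2 ℂ (fun _ : Fin n => H)).symm :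
      (Fin n → H) →L[ℂ] PiLp 2 (fun _ : Fin n => H)) ∘L
      ContinuousLinearMap.single ℂ (fun _ : Fin n => H) j
  have hincl : ∀ (S : H →L[ℂ] H) (j : Fin n) (y : H), incl j (S y) = diagonal n S (incl j y) := by
    intro S j y
    ext i
    rcases eq_or_ne i j with rfl | hij <;> simp [incl, *]
  have hsum : ∀ v : PiLp 2 (fun _ : Fin n => H), ∑ j, incl j (v j) = v := by
    intro v
    ext i
    simp [incl, Finset.sum_apply, Pi.single_apply]
  -- The matrix entries of the projection lie in the commutant of `π(A)`, so `T` commutes with them.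
  -- Hence the diagonal of `T` commutes with the projection and preserves `M`.
  let block (i j : Fin n) : H →L[ℂ] H :=
    PiLp.proj 2 (fun _ : Fin n => H) i ∘L M.starProjection ∘L incl j
  have hblock : ∀ i j, block i j ∈ Set.centralizer (Set.range π) := by
    rintro i j _ ⟨a, rfl⟩
    ext y
    simp [block, hincl, hP]
  have hexp : ∀ (v : PiLp 2 (fun _ : Fin n => H)) (i : Fin n),
      M.starProjection v i = ∑ j, block i j (v j) := by
    intro v i
    conv_lhs => rw [← hsum v, map_sum]
    simp [block]
  rw [← Submodule.starProjection_eq_self_iff]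
  ext i
  have hTb : ∀ j, block i j (T (x j)) = T (block i j (x j)) := fun j =>
    congrArg (fun S : H →L[ℂ] H => S (x j)) (hT _ (hblock i j))
  have hxi := hexp (WithLp.toLp 2 x) i
  rw [hxM] at hxi
  rw [hexp]
  simp only [diagonal_apply, hTb, ← map_sum]
  rw [← hxi]

theorem exists_forall_norm_apply_sub_lt {π : A →⋆ₙₐ[ℂ] (H →L[ℂ] H)}
    (hπ : ∀ y, (∀ a, π a y = 0) → y = 0) {T : H →L[ℂ] H} (hT : T ∈ generatedVN π)
    {n : ℕ} (x : Fin n → H) {ε : ℝ} (hε : 0 < ε) :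
    ∃ a : A, ∀ i, ‖π a (x i) - T (x i)‖ < ε := by
  obtain ⟨_, ⟨a, rfl⟩, ha⟩ :=
    Metric.mem_closure_iff.1 (diagonal_apply_mem_closure_orbit hπ hT x) ε hε
  refine ⟨a, fun i => lt_of_le_of_lt ?_ ha⟩
  rw [dist_comm, dist_eq_norm]
  exact PiLp.norm_apply_le (orbitMap π x a - diagonal n T (WithLp.toLp 2 x)) i

/-- Selfadjoint elements of `π(A)''` are approximated on finitely many vectors by `π(a)` with `a`
selfadjoint. -/
theorem exists_isSelfAdjoint_forall_norm_apply_sub_lt {π : A →⋆ₙₐ[ℂ] (H →L[ℂ] H)}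
    (hπ : ∀ y, (∀ a, π a y = 0) → y = 0) {T : H →L[ℂ] H} (hT : T ∈ generatedVN π)
    (hTs : IsSelfAdjoint T) {n : ℕ} (x : Fin n → H) {ε : ℝ} (hε : 0 < ε) :
    ∃ a : A, IsSelfAdjoint a ∧ ∀ i, ‖π a (x i) - T (x i)‖ < ε := by
  -- The adjoint is not strongly continuous, so taking selfadjoint parts of approximants fails.
  -- Instead, the selfadjoint elements form a real subspace, and density is tested with real
  -- orthogonality.
  let _ : InnerProductSpace ℝ (PiLp 2 (fun _ : Fin n => H)) := InnerProductSpace.complexToReal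
  let M : Submodule ℝ (PiLp 2 (fun _ : Fin n => H)) :=
    (selfAdjoint.submodule ℝ A).map ((orbitMap π x).restrictScalars ℝ)
  have key : diagonal n T (WithLp.toLp 2 x) ∈ M.topologicalClosure := by
    rw [← Submodule.orthogonal_orthogonal_eq_closure, Submodule.mem_orthogonal]
    intro y hy
    rw [Submodule.mem_orthogonal'] at hy
    have hre : ∀ v w : PiLp 2 (fun _ : Fin n => H), inner ℝ v w = ∑ i, (inner ℂ (v i) (w i)).re := by
      intro v w
      rw [real_inner_eq_re_inner ℂ, PiLp.inner_apply]
      simp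
    -- Testing `y` against `b + star b` gives a relation valid for all `b`, which passes to the
    -- limit `π(b) → T` taken on the `x i` and `y i` jointly. As `T` is selfadjoint, the two
    -- limiting sums coincide, so both vanish.
    have h0 : ∀ b : A, ∑ i, (inner ℂ (y i) (π b (x i))).re +
        ∑ i, (inner ℂ (π b (y i)) (x i)).re = 0 := by
      intro b
      have := hy (orbitMap π x (b + star b)) ⟨b + star b, IsSelfAdjoint.add_star_self b, rfl⟩
      rw [hre] at this
      simpa [inner_apply_eq_inner_star_apply, inner_add_right, Finset.sum_add_distrib] using this
    have h1 : ∑ i, (inner ℂ (T (y i)) (x i)).re = ∑ i, (inner ℂ (y i) (T (x i))).re := by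
      refine Finset.sum_congr rfl fun i _ => ?_
      rw [← ContinuousLinearMap.adjoint_inner_right, ← ContinuousLinearMap.star_eq_adjoint,
        hTs.star_eq]
    have happrox : ∀ k : ℕ, ∃ b : A, ∀ i : Fin (n + n), ‖π b (Fin.append x (fun i => y i) i) -
        T (Fin.append x (fun i => y i) i)‖ < 1 / ((k : ℝ) + 1) := fun k =>
      exists_forall_norm_apply_sub_lt hπ hT _ (by positivity)
    choose b hb using happrox
    have hbx : ∀ i, Tendsto (fun k => π (b k) (x i)) atTop (𝓝 (T (x i))) := by
      intro i
      rw [tendsto_iff_norm_sub_tendsto_zero]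
      refine squeeze_zero (fun _ => norm_nonneg _) (fun k => ?_)
        tendsto_one_div_add_atTop_nhds_zero_nat
      simpa using (hb k (Fin.castAdd n i)).le
    have hby : ∀ i, Tendsto (fun k => π (b k) (y i)) atTop (𝓝 (T (y i))) := by
      intro i
      rw [tendsto_iff_norm_sub_tendsto_zero]
      refine squeeze_zero (fun _ => norm_nonneg _) (fun k => ?_)
        tendsto_one_div_add_atTop_nhds_zero_nat
      simpa only [Fin.append_right] using (hb k (Fin.natAdd n i)).le
    have hlim : Tendsto (fun k => ∑ i, (inner ℂ (y i) (π (b k) (x i))).re +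
        ∑ i, (inner ℂ (π (b k) (y i)) (x i)).re) atTop
        (𝓝 (∑ i, (inner ℂ (y i) (T (x i))).re + ∑ i, (inner ℂ (T (y i)) (x i)).re)) := by
      refine Tendsto.add ?_ ?_
      · exact tendsto_finsetSum _ fun i _ => (Complex.continuous_re.tendsto _).comp
          (tendsto_const_nhds.inner (hbx i))
      · exact tendsto_finsetSum _ fun i _ => (Complex.continuous_re.tendsto _).comp
          ((hby i).inner tendsto_const_nhds)
    simp only [h0] at hlim
    have h2 := tendsto_nhds_unique hlim tendsto_const_nhds
    rw [h1] at h2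
    rw [hre]
    simp only [diagonal_apply]
    linarith
  obtain ⟨_, ⟨a, ha, rfl⟩, had⟩ := Metric.mem_closure_iff.1 key ε hε
  refine ⟨a, ha, fun i => lt_of_le_of_lt ?_ had⟩
  rw [dist_comm, dist_eq_norm]
  exact PiLp.norm_apply_le (orbitMap π x a - diagonal n T (WithLp.toLp 2 x)) i

end StrongApproximation

/-! ### Sequential Kaplansky density by bounded regularization -/

section BoundedApproximation

open Filter Topology
open scoped CStarAlgebra

section Regularize

variable {B : Type*} [CStarAlgebra B]

/-- The bounded function `t ↦ t / (1 + (δ t)²)` of a selfadjoint element; it tends to the element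
itself as `δ → 0`. -/
noncomputable def regularize (δ : ℝ) (s : B) : B :=
  cfc (fun t : ℝ => t * (1 + (δ * t) ^ 2)⁻¹) s

theorem one_add_sq_ne_zero (t : ℝ) : 1 + t ^ 2 ≠ 0 := by positivity

theorem continuous_inv_one_add_sq (δ : ℝ) : Continuous fun t : ℝ => (1 + (δ * t) ^ 2)⁻¹ :=
  Continuous.inv₀ (by fun_prop) fun t => one_add_sq_ne_zero (δ * t)

/-- The witness is `r = (1 + δ²s²)⁻¹`. These algebraic relations replace the functional calculus in
the estimates below. -/
theorem regularize_spec (δ : ℝ) {s : B} (hs : IsSelfAdjoint s) :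
    ∃ r : B, r * (1 + δ ^ 2 • (s * s)) = 1 ∧ (1 + δ ^ 2 • (s * s)) * r = 1 ∧
      regularize δ s = r * s ∧ regularize δ s = s * r ∧ ‖r‖ ≤ 1 := by
  have hc : ContinuousOn (fun t : ℝ => (1 + (δ * t) ^ 2)⁻¹) (spectrum ℝ s) :=
    (continuous_inv_one_add_sq δ).continuousOn
  have h1 : 1 + δ ^ 2 • (s * s) = cfc (fun t : ℝ => 1 + (δ * t) ^ 2) s := by
    rw [cfc_const_add _ _ s, show (fun t : ℝ => (δ * t) ^ 2) = fun t => δ ^ 2 • (t * t) by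
      ext t; simp; ring, cfc_smul _ _ s, cfc_mul _ _ s, cfc_id' ℝ s]
    simp
  have h2 : regularize δ s = s * cfc (fun t : ℝ => (1 + (δ * t) ^ 2)⁻¹) s := by
    rw [regularize, cfc_mul _ _ s (continuousOn_id' _) hc, cfc_id' ℝ s]
  refine ⟨cfc (fun t : ℝ => (1 + (δ * t) ^ 2)⁻¹) s, ?_, ?_, ?_, h2, ?_⟩
  · rw [h1, ← cfc_mul _ _ s hc, ← cfc_one ℝ s]
    exact cfc_congr fun t _ => inv_mul_cancel₀ (one_add_sq_ne_zero (δ * t))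
  · rw [h1, ← cfc_mul _ _ s (by fun_prop) hc, ← cfc_one ℝ s]
    exact cfc_congr fun t _ => mul_inv_cancel₀ (one_add_sq_ne_zero (δ * t))
  · rw [h2]
    have := cfc_commute_cfc (fun t : ℝ => t) (fun t : ℝ => (1 + (δ * t) ^ 2)⁻¹) s
    rw [cfc_id' ℝ s] at this
    exact this.eq
  · refine norm_cfc_le zero_le_one fun t _ => ?_
    rw [Real.norm_eq_abs, abs_of_nonneg (by positivity)]
    exact inv_le_one_of_one_le₀ (by nlinarith [sq_nonneg (δ * t)])

/-- The bound does not depend on `s`: regularizing makes an arbitrary family of approximants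
uniformly bounded. -/
theorem norm_regularize_le {δ : ℝ} (hδ : 0 < δ) (s : B) : ‖regularize δ s‖ ≤ δ⁻¹ := by
  refine norm_cfc_le (by positivity) fun t _ => ?_
  rw [Real.norm_eq_abs, abs_mul, abs_of_nonneg (a := (_)⁻¹) (by positivity), ← div_eq_mul_inv,
    div_le_iff₀ (by positivity), inv_mul_eq_div, le_div_iff₀ hδ]
  have : |t| * δ = |δ * t| := by rw [abs_mul, abs_of_pos hδ, mul_comm]
  rw [this]
  nlinarith [sq_abs (δ * t), sq_nonneg (|δ * t| - 1), sq_nonneg (|δ * t|)]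

theorem norm_sub_regularize_le (δ : ℝ) {s : B} (hs : IsSelfAdjoint s) :
    ‖s - regularize δ s‖ ≤ δ ^ 2 * (‖s‖ * ‖s‖ * ‖s‖) := by
  obtain ⟨r, -, h2, -, h4, h5⟩ := regularize_spec δ hs
  have : s - regularize δ s = δ ^ 2 • (s * s * s * r) := by
    have := congrArg (s * ·) h2
    simp only [mul_one] at this
    rw [h4]
    nth_rewrite 1 [← this]
    simp [add_mul, mul_add, mul_assoc]
  rw [this, norm_smul, Real.norm_of_nonneg (by positivity)]
  gcongr
  calc ‖s * s * s * r‖ ≤ ‖s‖ * ‖s‖ * ‖s‖ * ‖r‖ := by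
        refine (norm_mul_le _ _).trans ?_
        gcongr
        refine (norm_mul_le _ _).trans ?_
        gcongr
        exact norm_mul_le _ _
    _ ≤ ‖s‖ * ‖s‖ * ‖s‖ := mul_le_of_le_one_right (by positivity) h5

theorem tendsto_regularize {s : B} (hs : IsSelfAdjoint s) :
    Tendsto (fun n : ℕ => regularize (1 / ((n : ℝ) + 1)) s) atTop (𝓝 s) := by
  rw [tendsto_iff_norm_sub_tendsto_zero]
  have h0 : Tendsto (fun n : ℕ => (1 / ((n : ℝ) + 1)) ^ 2 * (‖s‖ * ‖s‖ * ‖s‖)) atTop (𝓝 0) := by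
    simpa using (tendsto_one_div_add_atTop_nhds_zero_nat.pow 2).mul_const (‖s‖ * ‖s‖ * ‖s‖)
  refine squeeze_zero (fun _ => norm_nonneg _) (fun n => ?_) h0
  rw [norm_sub_rev]
  exact norm_sub_regularize_le _ hs

/-- Resolvent type identity: the difference of two regularizations is controlled by the difference
of the elements applied on the right to elements that depend only on one of them. -/
theorem regularize_sub_regularize (δ : ℝ) {S : B} (hS : IsSelfAdjoint S) :
    ∃ R : B, ∀ s : B, IsSelfAdjoint s → ∃ r : B, ‖r‖ ≤ 1 ∧
      regularize δ s - regularize δ S =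
        r * ((s - S) * R) - δ ^ 2 • (regularize δ s * ((s - S) * regularize δ S)) := by
  obtain ⟨R, -, h2, -, h4, -⟩ := regularize_spec δ hS
  refine ⟨R, fun s hs => ?_⟩
  obtain ⟨r, k1, -, k3, -, k5⟩ := regularize_spec δ hs
  refine ⟨r, k5, ?_⟩
  -- One inserts `(1 + δ²S²)R = 1` to the right of `r s`, and `r(1 + δ²s²) = 1` to the left of `S
  -- R`. In the difference each remaining term contains the factor `s - S`.
  have e1 : r * s = r * s * R + δ ^ 2 • (r * s * (S * S * R)) := by
    have := congrArg (r * s * ·) h2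
    simpa [add_mul, mul_add] using this.symm
  have e2 : S * R = r * (S * R) + δ ^ 2 • (r * (s * s) * (S * R)) := by
    have := congrArg (· * (S * R)) k1
    simpa [add_mul, mul_add] using this.symm
  rw [k3, h4]
  nth_rewrite 1 [e1]
  nth_rewrite 1 [e2]
  simp only [mul_sub, sub_mul, smul_sub, mul_assoc]
  abel

end Regularize

variable {A : Type*} [NonUnitalCStarAlgebra A]
variable {H : Type*} [NormedAddCommGroup H] [InnerProductSpace ℂ H]

/-- A uniformly bounded sequence of operators that converges on a dense set of vectors converges
strongly. -/
theorem tendsto_apply_of_denseRange {ι : Type*} {u : ι → H} (hu : DenseRange u)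
    {S : ℕ → H →L[ℂ] H} {T : H →L[ℂ] H} {C : ℝ} (hS : ∀ n, ‖S n‖ ≤ C)
    (h : ∀ i, Tendsto (fun n => S n (u i)) atTop (𝓝 (T (u i)))) (x : H) :
    Tendsto (fun n => S n x) atTop (𝓝 (T x)) := by
  have hC : 0 ≤ C := (norm_nonneg _).trans (hS 0)
  rw [Metric.tendsto_atTop]
  intro ε hε
  obtain ⟨i, hi⟩ := Metric.denseRange_iff.1 hu x (ε / (2 * (C + ‖T‖ + 1))) (by positivity)
  obtain ⟨N, hN⟩ := Metric.tendsto_atTop.1 (h i) (ε / 2) (by positivity)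
  refine ⟨N, fun n hn => ?_⟩
  rw [dist_eq_norm] at hi ⊢
  have e : S n x - T x = S n (x - u i) + (S n (u i) - T (u i)) - T (x - u i) := by
    simp only [map_sub]; abel
  have h1 := (S n).le_of_opNorm_le (hS n) (x - u i)
  have h2 := T.le_opNorm (x - u i)
  have h3 := hN n hn
  rw [dist_eq_norm] at h3
  have h4 : (C + ‖T‖) * ‖x - u i‖ ≤ ε / 2 := by
    rw [lt_div_iff₀ (by positivity)] at hi
    nlinarith [norm_nonneg (x - u i)]
  rw [e]
  calc _ ≤ ‖S n (x - u i)‖ + ‖S n (u i) - T (u i)‖ + ‖T (x - u i)‖ :=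
        (norm_sub_le _ _).trans (by gcongr; exact norm_add_le _ _)
    _ < ε := by linarith

variable [CompleteSpace H]

/-- The function vanishes at `0`, so the non-unital calculus applies inside `A` and commutes with
`π`. -/
theorem exists_apply_eq_regularize (π : A →⋆ₙₐ[ℂ] (H →L[ℂ] H)) (δ : ℝ) {a : A}
    (ha : IsSelfAdjoint a) : ∃ b : A, π b = regularize δ (π a) := by
  have hc : Continuous fun t : ℝ => t * (1 + (δ * t) ^ 2)⁻¹ :=
    continuous_id.mul (continuous_inv_one_add_sq δ)
  have hπa : IsSelfAdjoint (π a) := ha.map π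
  refine ⟨cfcₙ (fun t : ℝ => t * (1 + (δ * t) ^ 2)⁻¹) a, ?_⟩
  rw [NonUnitalStarAlgHom.map_cfcₙ π _ a hc.continuousOn (by simp) (map_continuous π) ha hπa,
    cfcₙ_eq_cfc hc.continuousOn (by simp), regularize]

/-- As `R` depends only on `S`, closeness of `s` to `S` on the two fixed vectors `R x` and
`regularize δ S x` suffices, with no bound on `‖s‖`. -/
theorem norm_regularize_sub_apply_le {δ : ℝ} (hδ : 0 < δ) {S : H →L[ℂ] H} (hS : IsSelfAdjoint S) :
    ∃ R : H →L[ℂ] H, ∀ s : H →L[ℂ] H, IsSelfAdjoint s → ∀ x : H,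
      ‖(regularize δ s - regularize δ S) x‖ ≤ ‖(s - S) (R x)‖ +
        δ * ‖(s - S) (regularize δ S x)‖ := by
  obtain ⟨R, hR⟩ := regularize_sub_regularize δ hS
  refine ⟨R, fun s hs x => ?_⟩
  obtain ⟨r, hr, h⟩ := hR s hs
  rw [h]
  refine (norm_sub_le _ _).trans (add_le_add ?_ ?_)
  · exact (r.le_of_opNorm_le hr _).trans (one_mul _).le
  · calc ‖δ ^ 2 • regularize δ s ((s - S) (regularize δ S x))‖
        ≤ δ ^ 2 * (δ⁻¹ * ‖(s - S) (regularize δ S x)‖) := by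
          rw [norm_smul, Real.norm_of_nonneg (by positivity)]
          gcongr
          exact ContinuousLinearMap.le_of_opNorm_le _ (norm_regularize_le hδ s) _
      _ = δ * ‖(s - S) (regularize δ S x)‖ := by field_simp

/-- A sequential form of Kaplansky's density theorem, for the regularizations of a selfadjoint
operator. -/
theorem exists_seq_tendsto_regularize [TopologicalSpace.SeparableSpace H]
    {π : A →⋆ₙₐ[ℂ] (H →L[ℂ] H)} (hπ : ∀ y, (∀ a, π a y = 0) → y = 0) {T : H →L[ℂ] H}
    (hT : T ∈ generatedVN π) (hTs : IsSelfAdjoint T) {δ : ℝ} (hδ : 0 < δ) :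
    ∃ a : ℕ → A, ∀ x, Tendsto (fun n => π (a n) x) atTop (𝓝 (regularize δ T x)) := by
  obtain ⟨R, hR⟩ := norm_regularize_sub_apply_le hδ hTs
  let u := TopologicalSpace.denseSeq H
  -- The `n`-th approximant is controlled on the two test vectors attached to each of the first `n`
  -- dense vectors.
  have hex : ∀ n : ℕ, ∃ a : A, IsSelfAdjoint a ∧ ∀ i : Fin (n + n),
      ‖π a (Fin.append (fun j : Fin n => R (u j)) (fun j : Fin n => regularize δ T (u j)) i) -
        T (Fin.append (fun j : Fin n => R (u j)) (fun j : Fin n => regularize δ T (u j)) i)‖ <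
        1 / ((n : ℝ) + 1) := fun n =>
    exists_isSelfAdjoint_forall_norm_apply_sub_lt hπ hT hTs _ (by positivity)
  choose a has ha using hex
  choose b hb using fun n => exists_apply_eq_regularize π δ (has n)
  refine ⟨b, fun x => ?_⟩
  simp only [hb]
  refine tendsto_apply_of_denseRange (TopologicalSpace.denseRange_denseSeq H)
    (fun n => norm_regularize_le hδ _) (fun i => ?_) x
  rw [tendsto_iff_norm_sub_tendsto_zero]
  have h0 : Tendsto (fun n : ℕ => 1 / ((n : ℝ) + 1) + δ * (1 / ((n : ℝ) + 1))) atTop (𝓝 0) := by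
    simpa using tendsto_one_div_add_atTop_nhds_zero_nat.add
      (tendsto_one_div_add_atTop_nhds_zero_nat.const_mul δ)
  refine squeeze_zero' (Eventually.of_forall fun _ => norm_nonneg _) ?_ h0
  filter_upwards [eventually_gt_atTop i] with n hn
  have h1 := ha n (Fin.castAdd n ⟨i, hn⟩)
  have h2 := ha n (Fin.natAdd n ⟨i, hn⟩)
  rw [Fin.append_left] at h1
  rw [Fin.append_right] at h2
  exact (hR _ ((has n).map π) (u i)).trans
    (add_le_add h1.le (mul_le_mul_of_nonneg_left h2.le hδ.le))

end BoundedApproximation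

/-! ### Measurability and integrability of the lifted orbits -/

section Measurability

open Filter Topology
open scoped CStarAlgebra

variable {A : Type*} [NonUnitalCStarAlgebra A] [PartialOrder A] [StarOrderedRing A]

theorem continuous_toGNS (ω : A →ₚ[ℂ] ℂ) : Continuous (toGNS ω) := by
  rw [continuous_iff_continuousAt]
  intro a
  rw [ContinuousAt, tendsto_iff_norm_sub_tendsto_zero]
  have hc : Continuous fun b : A => √(ω (star (b - a) * (b - a))).re :=
    Real.continuous_sqrt.comp (Complex.continuous_re.comp ((map_continuous ω).comp (by fun_prop)))
  have := hc.tendsto a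
  simpa [← map_sub, norm_toGNS] using this

theorem separableSpace_gns [TopologicalSpace.SeparableSpace A] (ω : A →ₚ[ℂ] ℂ) :
    TopologicalSpace.SeparableSpace ω.GNS :=
  (denseRange_toGNS ω).separableSpace (continuous_toGNS ω)

/-- The GNS representation is nondegenerate. -/
theorem eq_zero_of_forall_gns_apply_eq_zero (ω : A →ₚ[ℂ] ℂ) (y : ω.GNS)
    (hy : ∀ a, ω.gnsNonUnitalStarAlgHom a y = 0) : y = 0 := by
  have h1 : ∀ b, inner ℂ (toGNS ω b) y = 0 := by
    intro b
    -- An approximate unit reaches `b` through products `e * b`, and `⟨π(e)[b], y⟩ = ⟨[b], π(star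
    -- e)y⟩ = 0`.
    have hlim : Tendsto (fun e => inner ℂ (toGNS ω (e * b)) y) (CStarAlgebra.approximateUnit A)
        (𝓝 (inner ℂ (toGNS ω b) y)) :=
      (((continuous_toGNS ω).tendsto b).comp
        ((CStarAlgebra.increasingApproximateUnit A).tendsto_mul_right b)).inner tendsto_const_nhds
    refine tendsto_nhds_unique hlim ?_
    simp [← gns_toGNS, inner_apply_eq_inner_star_apply, hy]
  have h2 : inner ℂ y y = 0 :=
    (denseRange_toGNS ω).induction_on (p := fun x => inner ℂ x y = 0) y
      (isClosed_eq (by fun_prop) (by fun_prop)) h1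
  exact inner_self_eq_zero.1 h2

variable {G : Type*} [Group G] {α : G →* (A ≃⋆ₐ[ℂ] A)} {ω : A →ₚ[ℂ] ℂ}

theorem liftedAction_apply (h : IsQuasiInvariant α ω) (g : G) (T : gnsVN ω) (x : ω.GNS) :
    (liftedAction h g T : ω.GNS →L[ℂ] ω.GNS) x =
      implementing h g ((T : ω.GNS →L[ℂ] ω.GNS) ((implementing h g).symm x)) := by
  change (implementing h g).conjStarAlgEquiv T x = _
  simp

theorem norm_liftedAction_apply_le (h : IsQuasiInvariant α ω) (g : G) (T : gnsVN ω) (x : ω.GNS) :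
    ‖(liftedAction h g T : ω.GNS →L[ℂ] ω.GNS) x‖ ≤ ‖(T : ω.GNS →L[ℂ] ω.GNS)‖ * ‖x‖ := by
  rw [liftedAction_apply, LinearIsometryEquiv.norm_map]
  exact (ContinuousLinearMap.le_opNorm _ _).trans_eq (by rw [LinearIsometryEquiv.norm_map])

variable [MeasurableSpace G]

theorem stronglyMeasurable_implementing_of_tendsto (h : IsQuasiInvariant α ω)
    {S : ℕ → ω.GNS →L[ℂ] ω.GNS} {T : ω.GNS →L[ℂ] ω.GNS}
    (hS : ∀ n x, StronglyMeasurable fun g => implementing h g (S n ((implementing h g).symm x)))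
    (hlim : ∀ x, Tendsto (fun n => S n x) atTop (𝓝 (T x))) (x : ω.GNS) :
    StronglyMeasurable fun g => implementing h g (T ((implementing h g).symm x)) :=
  stronglyMeasurable_of_tendsto atTop (fun n => hS n x) <| tendsto_pi_nhds.2 fun g =>
    ((implementing h g).continuous.tendsto _).comp (hlim _)

variable [TopologicalSpace.SeparableSpace A] [TopologicalSpace G] [BorelSpace G]

theorem stronglyMeasurable_implementing_gns (hα : ∀ a : A, Continuous fun g : G => α g a)
    (h : IsQuasiInvariant α ω) (a : A) (x : ω.GNS) : StronglyMeasurable fun g =>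
      implementing h g (ω.gnsNonUnitalStarAlgHom a ((implementing h g).symm x)) := by
  have := separableSpace_gns ω
  have : SecondCountableTopology ω.GNS := UniformSpace.secondCountable_of_separable _
  have e : (fun g => implementing h g (ω.gnsNonUnitalStarAlgHom a ((implementing h g).symm x))) =
      fun g => ω.gnsNonUnitalStarAlgHom (α g a) x := by
    ext1 g
    rw [← implementing_spec h g a]
    simp
  rw [e]
  have hc : Continuous fun g => ω.gnsNonUnitalStarAlgHom (α g a) :=
    (map_continuous ω.gnsNonUnitalStarAlgHom).comp (hα a)
  exact (hc.clm_apply continuous_const).stronglyMeasurable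

theorem stronglyMeasurable_implementing_of_isSelfAdjoint
    (hα : ∀ a : A, Continuous fun g : G => α g a) (h : IsQuasiInvariant α ω)
    {T : ω.GNS →L[ℂ] ω.GNS} (hT : T ∈ gnsVN ω) (hTs : IsSelfAdjoint T) (x : ω.GNS) :
    StronglyMeasurable fun g => implementing h g (T ((implementing h g).symm x)) := by
  have := separableSpace_gns ω
  refine stronglyMeasurable_implementing_of_tendsto h
    (S := fun n : ℕ => regularize (1 / ((n : ℝ) + 1)) T) (fun n y => ?_) (fun y => ?_) x
  · obtain ⟨a, ha⟩ := exists_seq_tendsto_regularize (eq_zero_of_forall_gns_apply_eq_zero ω) hT hTs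
      (δ := 1 / ((n : ℝ) + 1)) (by positivity)
    exact stronglyMeasurable_implementing_of_tendsto h
      (fun n z => stronglyMeasurable_implementing_gns hα h (a n) z) ha y
  · exact ((ContinuousLinearMap.apply ℂ ω.GNS y).continuous.tendsto T).comp
      (tendsto_regularize hTs)

theorem stronglyMeasurable_liftedAction (hα : ∀ a : A, Continuous fun g : G => α g a)
    (h : IsQuasiInvariant α ω) (T : gnsVN ω) (x : ω.GNS) :
    StronglyMeasurable fun g => (liftedAction h g T : ω.GNS →L[ℂ] ω.GNS) x := by
  have hre : (realPart (T : ω.GNS →L[ℂ] ω.GNS) : ω.GNS →L[ℂ] ω.GNS) ∈ gnsVN ω := by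
    rw [realPart_apply_coe, ← Complex.coe_smul]
    exact SMulMemClass.smul_mem _ (add_mem T.2 (star_mem T.2))
  have him : (imaginaryPart (T : ω.GNS →L[ℂ] ω.GNS) : ω.GNS →L[ℂ] ω.GNS) ∈ gnsVN ω := by
    rw [imaginaryPart_apply_coe, ← Complex.coe_smul]
    exact SMulMemClass.smul_mem _ (SMulMemClass.smul_mem _ (sub_mem T.2 (star_mem T.2)))
  have h1 := stronglyMeasurable_implementing_of_isSelfAdjoint hα h hre (realPart _).2 x
  have h2 := stronglyMeasurable_implementing_of_isSelfAdjoint hα h him (imaginaryPart _).2 x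
  convert! h1.add (h2.const_smul Complex.I) using 1
  ext1 g
  rw [liftedAction_apply]
  nth_rewrite 1 [← realPart_add_I_smul_imaginaryPart (T : ω.GNS →L[ℂ] ω.GNS)]
  simp

theorem integrable_liftedAction (μ : Measure G) [IsFiniteMeasure μ]
    (hα : ∀ a : A, Continuous fun g : G => α g a) (h : IsQuasiInvariant α ω) (T : gnsVN ω)
    (x : ω.GNS) : Integrable (fun g => (liftedAction h g T : ω.GNS →L[ℂ] ω.GNS) x) μ :=
  .of_bound (stronglyMeasurable_liftedAction hα h T x).aestronglyMeasurable _
    (.of_forall fun g => norm_liftedAction_apply_le h g T x)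

end Measurability

/-! ### Strong limits of increasing sequences and suprema of directed sets -/

section MonotoneLimits

open Filter Topology

variable {H : Type*} [NormedAddCommGroup H] [InnerProductSpace ℂ H]

theorem tendsto_reApplyInnerSelf {S : ℕ → H →L[ℂ] H} {T : H →L[ℂ] H} {x : H}
    (h : Tendsto (fun n => S n x) atTop (𝓝 (T x))) :
    Tendsto (fun n => (S n).reApplyInnerSelf x) atTop (𝓝 (T.reApplyInnerSelf x)) :=
  (RCLike.continuous_re.tendsto _).comp (h.inner tendsto_const_nhds)

variable [CompleteSpace H]

theorem le_iff_reApplyInnerSelf_le {S T : H →L[ℂ] H} (hS : IsSelfAdjoint S)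
    (hT : IsSelfAdjoint T) : S ≤ T ↔ ∀ x, S.reApplyInnerSelf x ≤ T.reApplyInnerSelf x := by
  rw [ContinuousLinearMap.le_def, ContinuousLinearMap.isPositive_def', and_iff_right (hT.sub hS)]
  refine forall_congr' fun x => ?_
  simp [ContinuousLinearMap.reApplyInnerSelf, inner_sub_left]

theorem reApplyInnerSelf_mono {S T : H →L[ℂ] H} (h : S ≤ T) (x : H) :
    S.reApplyInnerSelf x ≤ T.reApplyInnerSelf x := by
  have := (ContinuousLinearMap.isPositive_def'.1 ((ContinuousLinearMap.le_def S T).1 h)).2 x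
  simpa [ContinuousLinearMap.reApplyInnerSelf, inner_sub_left] using this

theorem isSelfAdjoint_of_ge {S T : H →L[ℂ] H} (hS : IsSelfAdjoint S) (h : S ≤ T) :
    IsSelfAdjoint T := by
  simpa using ((ContinuousLinearMap.le_def S T).1 h).isSelfAdjoint.add hS

/-- With `T = b*b` one has `‖Tx‖² ≤ ‖b‖²‖bx‖²`. Applied to differences in an increasing sequence, it
upgrades convergence of quadratic forms to strong convergence. -/
theorem norm_apply_sq_le_of_nonneg {T : H →L[ℂ] H} (hT : 0 ≤ T) (x : H) :
    ‖T x‖ ^ 2 ≤ ‖T‖ * T.reApplyInnerSelf x := by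
  obtain ⟨b, rfl⟩ := CStarAlgebra.nonneg_iff_eq_star_mul_self.1 hT
  have h1 : (star b * b).reApplyInnerSelf x = ‖b x‖ ^ 2 := by
    rw [ContinuousLinearMap.reApplyInnerSelf, mul_apply_eq_comp,
      ContinuousLinearMap.star_eq_adjoint, ContinuousLinearMap.adjoint_inner_left,
      inner_self_eq_norm_sq]
  rw [h1, CStarRing.norm_star_mul_self, ← pow_two, ← mul_pow]
  gcongr
  rw [← norm_star b]
  exact (star b).le_opNorm (b x)

theorem _root_.VonNeumannAlgebra.mem_of_tendsto (R : VonNeumannAlgebra H) {S : ℕ → H →L[ℂ] H}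
    {T : H →L[ℂ] H} (hS : ∀ n, S n ∈ R) (h : ∀ x, Tendsto (fun n => S n x) atTop (𝓝 (T x))) :
    T ∈ R := by
  rw [← VonNeumannAlgebra.commutant_commutant R, VonNeumannAlgebra.mem_commutant_iff]
  intro B hB
  ext x
  have h1 : Tendsto (fun n => B (S n x)) atTop (𝓝 (B (T x))) := (B.continuous.tendsto _).comp (h x)
  refine tendsto_nhds_unique h1 ((h (B x)).congr fun n => ?_)
  exact congrArg (fun C : H →L[ℂ] H => C x) (VonNeumannAlgebra.mem_commutant_iff.1 hB _ (hS n))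

/-- A bounded increasing sequence of positive operators converges strongly. -/
theorem exists_tendsto_of_monotone {S : ℕ → H →L[ℂ] H} (hmono : Monotone S) {T : H →L[ℂ] H}
    (h0 : ∀ n, 0 ≤ S n) (hT : ∀ n, S n ≤ T) :
    ∃ L : H →L[ℂ] H, ∀ x, Tendsto (fun n => S n x) atTop (𝓝 (L x)) := by
  have hlim : ∀ x, ∃ y, Tendsto (fun n => S n x) atTop (𝓝 y) := by
    intro x
    refine cauchySeq_tendsto_of_complete ?_
    have hm : Monotone fun n => (S n).reApplyInnerSelf x :=
      fun m n hmn => reApplyInnerSelf_mono (hmono hmn) x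
    have hb : BddAbove (Set.range fun n => (S n).reApplyInnerSelf x) :=
      ⟨T.reApplyInnerSelf x, by rintro _ ⟨n, rfl⟩; exact reApplyInnerSelf_mono (hT n) x⟩
    have hl := tendsto_atTop_ciSup hm hb
    set l := ⨆ n, (S n).reApplyInnerSelf x
    refine cauchySeq_of_le_tendsto_0' (fun n => √(‖T‖ * (l - (S n).reApplyInnerSelf x))) ?_ ?_
    · intro n m hnm
      rw [dist_comm, dist_eq_norm]
      refine Real.le_sqrt_of_sq_le ?_
      have hpos : 0 ≤ S m - S n := sub_nonneg.2 (hmono hnm)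
      have hle : S m - S n ≤ T := (sub_le_self _ (h0 n)).trans (hT m)
      have h2 := norm_apply_sq_le_of_nonneg hpos x
      have h3 : (S m - S n).reApplyInnerSelf x =
          (S m).reApplyInnerSelf x - (S n).reApplyInnerSelf x := by
        simp [ContinuousLinearMap.reApplyInnerSelf, inner_sub_left]
      have h4 : (S m).reApplyInnerSelf x ≤ l := le_ciSup hb m
      rw [sub_apply] at h2
      refine h2.trans ?_
      rw [h3]
      have h5 := CStarAlgebra.norm_le_norm_of_nonneg_of_le hpos hle
      have h6 := sub_nonneg.2 (hm hnm)
      gcongr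
    · have h7 : Tendsto (fun n => ‖T‖ * (l - (S n).reApplyInnerSelf x)) atTop (𝓝 0) := by
        simpa using (tendsto_const_nhds (x := l)).sub hl |>.const_mul ‖T‖
      simpa only [Real.sqrt_zero] using h7.sqrt
  choose f hf using hlim
  exact ⟨continuousLinearMapOfTendsto S (tendsto_pi_nhds.2 hf), hf⟩

theorem isSelfAdjoint_of_tendsto {S : ℕ → H →L[ℂ] H} {T : H →L[ℂ] H}
    (hS : ∀ n, IsSelfAdjoint (S n)) (h : ∀ x, Tendsto (fun n => S n x) atTop (𝓝 (T x))) :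
    IsSelfAdjoint T := by
  rw [ContinuousLinearMap.isSelfAdjoint_iff_isSymmetric]
  intro x y
  refine tendsto_nhds_unique ((h x).inner tendsto_const_nhds)
    ((tendsto_const_nhds.inner (h y)).congr fun n => ?_)
  exact ((ContinuousLinearMap.isSelfAdjoint_iff_isSymmetric.1 (hS n)) x y).symm

theorem exists_monotone_seq_ge {P : Type*} [Preorder P] {D : Set P} (hD : DirectedOn (· ≤ ·) D)
    (e : ℕ → P) (he : ∀ n, e n ∈ D) :
    ∃ S : ℕ → P, Monotone S ∧ (∀ n, S n ∈ D) ∧ ∀ n, e n ≤ S n := by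
  choose! j hjD hj1 hj2 using hD
  let S : ℕ → P := fun n => Nat.rec (e 0) (fun k s => j s (e (k + 1))) n
  have hSD : ∀ n, S n ∈ D := by
    intro n
    induction n with
    | zero => exact he 0
    | succ n ih => exact hjD _ ih _ (he (n + 1))
  refine ⟨S, monotone_nat_of_le_succ fun n => hj1 _ (hSD n) _ (he (n + 1)), hSD, fun n => ?_⟩
  cases n with
  | zero => exact le_rfl
  | succ n => exact hj2 _ (hSD n) _ (he (n + 1))

/-- On a separable Hilbert space, the supremum of a bounded directed set of positive elements of a
von Neumann algebra is the strong limit of a sequence in the set. -/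
theorem exists_seq_tendsto_of_isLUB [TopologicalSpace.SeparableSpace H] {R : VonNeumannAlgebra H}
    {D : Set R} {T : R} (hne : D.Nonempty) (hD : DirectedOn (· ≤ ·) D) (h0 : ∀ S ∈ D, 0 ≤ S)
    (hT : IsLUB D T) :
    ∃ S : ℕ → R, (∀ n, S n ∈ D) ∧
      ∀ x, Tendsto (fun n => (S n : H →L[ℂ] H) x) atTop (𝓝 ((T : H →L[ℂ] H) x)) := by
  let u := TopologicalSpace.denseSeq H
  let q (x : H) (S : R) : ℝ := (S : H →L[ℂ] H).reApplyInnerSelf x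
  have hqm : ∀ x {S S' : R}, S ≤ S' → q x S ≤ q x S' := fun x S S' h => reApplyInnerSelf_mono h x
  have hbdd : ∀ x, BddAbove (q x '' D) := by
    intro x
    refine ⟨q x T, ?_⟩
    rintro _ ⟨S, hS, rfl⟩
    exact hqm x (hT.1 hS)
  have hseq : ∀ i : ℕ, ∃ d : ℕ → R, (∀ n, d n ∈ D) ∧
      Tendsto (fun n => q (u i) (d n)) atTop (𝓝 (sSup (q (u i) '' D))) := by
    intro i
    obtain ⟨v, -, hv, hvD⟩ := exists_seq_tendsto_sSup (hne.image (q (u i))) (hbdd (u i))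
    choose d hdD hd using hvD
    exact ⟨d, hdD, by simpa only [hd] using hv⟩
  choose d hdD hd using hseq
  -- The pairing of `ℕ × ℕ` with `ℕ` lists all maximizing sequences as one, so a single increasing
  -- sequence dominates every `d i n`.
  obtain ⟨S, hSm, hSD, hS⟩ := exists_monotone_seq_ge hD
    (fun n => d (Nat.unpair n).1 (Nat.unpair n).2) (fun n => hdD _ _)
  have hS0 : ∀ n, (0 : H →L[ℂ] H) ≤ S n := fun n => h0 _ (hSD n)
  have hST : ∀ n, (S n : H →L[ℂ] H) ≤ T := fun n => hT.1 (hSD n)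
  obtain ⟨L, hL⟩ := exists_tendsto_of_monotone (S := fun n => (S n : H →L[ℂ] H))
    (fun m n h => hSm h) hS0 hST
  have hLsa : IsSelfAdjoint L := isSelfAdjoint_of_tendsto (fun n => .of_nonneg (hS0 n)) hL
  have hTsa : IsSelfAdjoint (T : H →L[ℂ] H) := .of_nonneg ((hS0 0).trans (hST 0))
  have hSL : ∀ n x, q x (S n) ≤ L.reApplyInnerSelf x := fun n x =>
    Monotone.ge_of_tendsto (f := fun n => q x (S n)) (fun m n h => hqm x (hSm h))
      (tendsto_reApplyInnerSelf (hL x)) n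
  -- On the dense vectors the form of `L` dominates the supremum of the forms over `D`; continuity
  -- in `x` extends this to all vectors. Since `L` lies in `R`, the least upper bound `T` is at most
  -- `L`.
  have hLub : (⟨L, R.mem_of_tendsto (fun n => (S n).2) hL⟩ : R) ∈ upperBounds D := by
    intro B hB
    change (B : H →L[ℂ] H) ≤ L
    have hB0 : (0 : H →L[ℂ] H) ≤ B := h0 B hB
    rw [le_iff_reApplyInnerSelf_le (.of_nonneg hB0) hLsa]
    intro x
    refine (TopologicalSpace.denseRange_denseSeq H).induction_on x (isClosed_le
      (ContinuousLinearMap.reApplyInnerSelf_continuous _)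
      (ContinuousLinearMap.reApplyInnerSelf_continuous _)) fun i => ?_
    refine (le_csSup (hbdd (u i)) ⟨B, hB, rfl⟩).trans (le_of_tendsto' (hd i) fun n => ?_)
    refine le_trans (hqm _ ?_) (hSL (Nat.pair i n) (u i))
    simpa using hS (Nat.pair i n)
  have hTL : (T : H →L[ℂ] H) ≤ L := hT.2 hLub
  have hLT : L ≤ T := (le_iff_reApplyInnerSelf_le hLsa hTsa).2 fun x =>
    le_of_tendsto' (tendsto_reApplyInnerSelf (hL x)) fun n => reApplyInnerSelf_mono (hST n) x
  exact ⟨S, hSD, fun x => by rw [le_antisymm hTL hLT]; exact hL x⟩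

end MonotoneLimits

/-! ### The averaging map: positivity, faithfulness, normality -/

section Average

open Filter Topology

variable {A : Type*} [NonUnitalCStarAlgebra A] [PartialOrder A] [StarOrderedRing A]
variable {G : Type*} [Group G] {α : G →* (A ≃⋆ₐ[ℂ] A)} {ω : A →ₚ[ℂ] ℂ}

theorem reApplyInnerSelf_liftedAction (h : IsQuasiInvariant α ω) (g : G) (T : gnsVN ω)
    (x : ω.GNS) : (liftedAction h g T : ω.GNS →L[ℂ] ω.GNS).reApplyInnerSelf x =
      (T : ω.GNS →L[ℂ] ω.GNS).reApplyInnerSelf ((implementing h g).symm x) := by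
  rw [ContinuousLinearMap.reApplyInnerSelf, ContinuousLinearMap.reApplyInnerSelf,
    liftedAction_apply, ← LinearIsometryEquiv.inner_map_map (implementing h g).symm]
  simp

variable [TopologicalSpace.SeparableSpace A]
variable [TopologicalSpace G] [MeasurableSpace G] [BorelSpace G]

theorem integrable_reApplyInnerSelf_liftedAction (μ : Measure G) [IsFiniteMeasure μ]
    (hα : ∀ a : A, Continuous fun g : G => α g a) (h : IsQuasiInvariant α ω) (T : gnsVN ω)
    (x : ω.GNS) :
    Integrable (fun g => (liftedAction h g T : ω.GNS →L[ℂ] ω.GNS).reApplyInnerSelf x) μ :=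
  ((integrable_liftedAction μ hα h T x).inner_const x).re

/-- The average `x ↦ ∫ α̃_g(T) x dg` of an operator `T` over the lifted action. -/
noncomputable def averageOperator (μ : Measure G) [IsProbabilityMeasure μ]
    (hα : ∀ a : A, Continuous fun g : G => α g a) (h : IsQuasiInvariant α ω) (T : gnsVN ω) :
    ω.GNS →L[ℂ] ω.GNS :=
  LinearMap.mkContinuous
    { toFun := fun x => ∫ g, (liftedAction h g T : ω.GNS →L[ℂ] ω.GNS) x ∂μ
      map_add' := fun x y => by
        simp only [map_add]
        exact integral_add (integrable_liftedAction μ hα h T x) (integrable_liftedAction μ hα h T y)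
      map_smul' := fun c x => by
        simp only [map_smul]
        exact integral_smul c _ }
    ‖(T : ω.GNS →L[ℂ] ω.GNS)‖ fun x => by
      simpa using norm_integral_le_of_norm_le_const (μ := μ)
        (.of_forall fun g => norm_liftedAction_apply_le h g T x)

theorem averageOperator_apply (μ : Measure G) [IsProbabilityMeasure μ]
    (hα : ∀ a : A, Continuous fun g : G => α g a) (h : IsQuasiInvariant α ω) (T : gnsVN ω)
    (x : ω.GNS) : averageOperator μ hα h T x =
      ∫ g, (liftedAction h g T : ω.GNS →L[ℂ] ω.GNS) x ∂μ :=
  rfl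

theorem averageOperator_mem (μ : Measure G) [IsProbabilityMeasure μ]
    (hα : ∀ a : A, Continuous fun g : G => α g a) (h : IsQuasiInvariant α ω) (T : gnsVN ω) :
    averageOperator μ hα h T ∈ gnsVN ω := by
  intro S hS
  ext x
  change S (averageOperator μ hα h T x) = averageOperator μ hα h T (S x)
  rw [averageOperator_apply, averageOperator_apply,
    ← S.integral_comp_comm (integrable_liftedAction μ hα h T x)]
  congr 1
  ext1 g
  exact congrArg (fun B : ω.GNS →L[ℂ] ω.GNS => B x) ((liftedAction h g T).2 S hS)

/-- The averaging map `T ↦ ∫ α̃_g(T) dg` on `π_ω(A)''`. -/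
noncomputable def average (μ : Measure G) [IsProbabilityMeasure μ]
    (hα : ∀ a : A, Continuous fun g : G => α g a) (h : IsQuasiInvariant α ω) :
    gnsVN ω →ₗ[ℂ] gnsVN ω where
  toFun T := ⟨averageOperator μ hα h T, averageOperator_mem μ hα h T⟩
  map_add' S T := by
    ext x
    change averageOperator μ hα h (S + T) x =
      averageOperator μ hα h S x + averageOperator μ hα h T x
    simp only [averageOperator_apply, map_add]
    exact integral_add (integrable_liftedAction μ hα h S x) (integrable_liftedAction μ hα h T x)
  map_smul' c T := by
    ext x
    change averageOperator μ hα h (c • T) x = c • averageOperator μ hα h T x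
    simp only [averageOperator_apply, map_smul]
    exact integral_smul c _

theorem coe_average_apply (μ : Measure G) [IsProbabilityMeasure μ]
    (hα : ∀ a : A, Continuous fun g : G => α g a) (h : IsQuasiInvariant α ω) (T : gnsVN ω)
    (x : ω.GNS) : (average μ hα h T : ω.GNS →L[ℂ] ω.GNS) x =
      ∫ g, (liftedAction h g T : ω.GNS →L[ℂ] ω.GNS) x ∂μ :=
  rfl

variable (μ : Measure G) [IsProbabilityMeasure μ]
variable (hα : ∀ a : A, Continuous fun g : G => α g a) (h : IsQuasiInvariant α ω)

theorem reApplyInnerSelf_average (T : gnsVN ω) (x : ω.GNS) :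
    (average μ hα h T : ω.GNS →L[ℂ] ω.GNS).reApplyInnerSelf x =
      ∫ g, (liftedAction h g T : ω.GNS →L[ℂ] ω.GNS).reApplyInnerSelf x ∂μ := by
  have hi := integrable_liftedAction μ hα h T x
  have h1 := integral_re (hi.const_inner (𝕜 := ℂ) x)
  rw [integral_inner hi] at h1
  simp only [ContinuousLinearMap.reApplyInnerSelf, coe_average_apply]
  simp only [inner_re_symm (𝕜 := ℂ) _ x]
  exact h1.symm

theorem isSelfAdjoint_average {T : gnsVN ω} (hT : IsSelfAdjoint (T : ω.GNS →L[ℂ] ω.GNS)) :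
    IsSelfAdjoint (average μ hα h T : ω.GNS →L[ℂ] ω.GNS) := by
  rw [ContinuousLinearMap.isSelfAdjoint_iff_isSymmetric]
  intro x y
  change inner ℂ ((average μ hα h T : ω.GNS →L[ℂ] ω.GNS) x) y =
    inner ℂ x ((average μ hα h T : ω.GNS →L[ℂ] ω.GNS) y)
  rw [coe_average_apply, coe_average_apply, ← integral_inner (integrable_liftedAction μ hα h T y),
    ← inner_conj_symm, ← integral_inner (integrable_liftedAction μ hα h T x), ← integral_conj]
  congr 1
  ext1 g
  rw [inner_conj_symm, liftedAction_apply, liftedAction_apply,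
    ← LinearIsometryEquiv.inner_map_map (implementing h g).symm,
    ← LinearIsometryEquiv.inner_map_map (implementing h g).symm x]
  simp only [LinearIsometryEquiv.symm_apply_apply]
  exact (ContinuousLinearMap.isSelfAdjoint_iff_isSymmetric.1 hT) _ _

/-- Positivity of `S` makes both averages selfadjoint, so their order can be read off from the
integrated quadratic forms. -/
theorem average_mono {S T : gnsVN ω} (hS : 0 ≤ S) (hST : S ≤ T) :
    average μ hα h S ≤ average μ hα h T := by
  have hS0 : (0 : ω.GNS →L[ℂ] ω.GNS) ≤ S := hS
  have hT0 : (0 : ω.GNS →L[ℂ] ω.GNS) ≤ T := hS0.trans hST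
  refine (le_iff_reApplyInnerSelf_le (isSelfAdjoint_average μ hα h (.of_nonneg hS0))
    (isSelfAdjoint_average μ hα h (.of_nonneg hT0))).2 fun x => ?_
  rw [reApplyInnerSelf_average, reApplyInnerSelf_average]
  refine integral_mono (integrable_reApplyInnerSelf_liftedAction μ hα h S x)
    (integrable_reApplyInnerSelf_liftedAction μ hα h T x) fun g => ?_
  simp only [reApplyInnerSelf_liftedAction]
  exact reApplyInnerSelf_mono hST _

theorem average_nonneg {T : gnsVN ω} (hT : 0 ≤ T) : 0 ≤ average μ hα h T := by
  simpa using average_mono μ hα h le_rfl hT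

theorem average_one : average μ hα h 1 = 1 := by
  ext x
  simp [coe_average_apply]

/-- The averaging map is faithful. -/
theorem eq_zero_of_average_star_mul_self_eq_zero {T : gnsVN ω}
    (hT : average μ hα h (star T * T) = 0) : T = 0 := by
  have := separableSpace_gns ω
  let u := TopologicalSpace.denseSeq ω.GNS
  have hq : ∀ (g : G) (x : ω.GNS),
      (liftedAction h g (star T * T) : ω.GNS →L[ℂ] ω.GNS).reApplyInnerSelf x =
        ‖(liftedAction h g T : ω.GNS →L[ℂ] ω.GNS) x‖ ^ 2 := by
    intro g x
    rw [map_mul, map_star]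
    change RCLike.re (inner ℂ ((star (liftedAction h g T : ω.GNS →L[ℂ] ω.GNS))
      ((liftedAction h g T : ω.GNS →L[ℂ] ω.GNS) x)) x) = _
    rw [ContinuousLinearMap.star_eq_adjoint, ContinuousLinearMap.adjoint_inner_left,
      inner_self_eq_norm_sq]
  have hae : ∀ i, ∀ᵐ g ∂μ, (liftedAction h g T : ω.GNS →L[ℂ] ω.GNS) (u i) = 0 := by
    intro i
    have h1 := reApplyInnerSelf_average μ hα h (star T * T) (u i)
    have h2 := integrable_reApplyInnerSelf_liftedAction μ hα h (star T * T) (u i)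
    simp only [hq] at h1 h2
    rw [hT] at h1
    have h3 : ∫ g, ‖(liftedAction h g T : ω.GNS →L[ℂ] ω.GNS) (u i)‖ ^ 2 ∂μ = 0 := by
      rw [← h1]
      simp [ContinuousLinearMap.reApplyInnerSelf]
    rw [integral_eq_zero_iff_of_nonneg (fun g => by positivity) h2] at h3
    filter_upwards [h3] with g hg
    simpa using hg
  -- Countably many null sets are discarded, and a probability measure leaves some `g`; injectivity
  -- of `α̃_g` then carries vanishing back to `T`.
  obtain ⟨g, hg⟩ := (ae_all_iff.2 hae).exists
  have hz : (liftedAction h g T : ω.GNS →L[ℂ] ω.GNS) = 0 := by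
    ext x
    exact (TopologicalSpace.denseRange_denseSeq ω.GNS).induction_on
      (p := fun x => (liftedAction h g T : ω.GNS →L[ℂ] ω.GNS) x = 0) x
      (isClosed_eq (by fun_prop) (by fun_prop)) hg
  exact (map_eq_zero_iff _ (liftedAction h g).injective).1 (Subtype.ext hz)

/-- The averaging map preserves suprema of bounded directed sets of positive elements. -/
theorem isLUB_image_average {D : Set (gnsVN ω)} {T : gnsVN ω} (hne : D.Nonempty)
    (hD : DirectedOn (· ≤ ·) D) (h0 : ∀ S ∈ D, 0 ≤ S) (hT : IsLUB D T) :
    IsLUB (average μ hα h '' D) (average μ hα h T) := by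
  have := separableSpace_gns ω
  constructor
  · rintro _ ⟨S, hS, rfl⟩
    exact average_mono μ hα h (h0 S hS) (hT.1 hS)
  intro B hB
  obtain ⟨S, hSD, hS⟩ := exists_seq_tendsto_of_isLUB hne hD h0 hT
  have hS0 : ∀ n, (0 : ω.GNS →L[ℂ] ω.GNS) ≤ S n := fun n => h0 _ (hSD n)
  have hST : ∀ n, (S n : ω.GNS →L[ℂ] ω.GNS) ≤ T := fun n => hT.1 (hSD n)
  have hSB : ∀ n, (average μ hα h (S n) : ω.GNS →L[ℂ] ω.GNS) ≤ B := fun n => hB ⟨_, hSD n, rfl⟩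
  have hTsa := isSelfAdjoint_average μ hα h
    (IsSelfAdjoint.of_nonneg ((hS0 0).trans (hST 0)) : IsSelfAdjoint (T : ω.GNS →L[ℂ] ω.GNS))
  have hBsa := isSelfAdjoint_of_ge (isSelfAdjoint_average μ hα h (.of_nonneg (hS0 0))) (hSB 0)
  refine (le_iff_reApplyInnerSelf_le hTsa hBsa).2 fun x => ?_
  have hlim : Tendsto (fun n => (average μ hα h (S n) : ω.GNS →L[ℂ] ω.GNS).reApplyInnerSelf x)
      atTop (𝓝 ((average μ hα h T : ω.GNS →L[ℂ] ω.GNS).reApplyInnerSelf x)) := by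
    simp only [reApplyInnerSelf_average]
    -- Since `0 ≤ S n ≤ T`, the form of `α̃_g(T)` at `x` dominates, uniformly in `n`.
    refine tendsto_integral_of_dominated_convergence
      (fun g => (liftedAction h g T : ω.GNS →L[ℂ] ω.GNS).reApplyInnerSelf x)
      (fun n => (integrable_reApplyInnerSelf_liftedAction μ hα h (S n) x).aestronglyMeasurable)
      (integrable_reApplyInnerSelf_liftedAction μ hα h T x)
      (fun n => .of_forall fun g => ?_) (.of_forall fun g => ?_)
    · simp only [reApplyInnerSelf_liftedAction]
      have := reApplyInnerSelf_mono (hS0 n) ((implementing h g).symm x)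
      rw [Real.norm_of_nonneg (by simpa [ContinuousLinearMap.reApplyInnerSelf] using this)]
      exact reApplyInnerSelf_mono (hST n) _
    · simp only [reApplyInnerSelf_liftedAction]
      exact tendsto_reApplyInnerSelf (hS _)
  exact le_of_tendsto' hlim fun n => reApplyInnerSelf_mono (hSB n) x

theorem IsNormalState.comp_average {φ : gnsVN ω →ₗ[ℂ] ℂ} (hφ : IsNormalState (gnsVN ω) φ) :
    IsNormalState (gnsVN ω) (φ ∘ₗ average μ hα h) where
  nonneg T hT := hφ.nonneg _ (average_nonneg μ hα h hT)
  map_one := by rw [LinearMap.comp_apply, average_one, hφ.map_one]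
  normal D T hne hD h0 hT := by
    have hD' : DirectedOn (· ≤ ·) (average μ hα h '' D) := by
      rintro _ ⟨S₁, h₁, rfl⟩ _ ⟨S₂, h₂, rfl⟩
      obtain ⟨S, hS, hS₁, hS₂⟩ := hD S₁ h₁ S₂ h₂
      exact ⟨_, ⟨S, hS, rfl⟩, average_mono μ hα h (h0 _ h₁) hS₁, average_mono μ hα h (h0 _ h₂) hS₂⟩
    have h0' : ∀ S ∈ average μ hα h '' D, 0 ≤ S := by
      rintro _ ⟨S, hS, rfl⟩
      exact average_nonneg μ hα h (h0 S hS)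
    simpa only [Set.image_image, LinearMap.comp_apply] using
      hφ.normal _ _ (hne.image _) hD' h0' (isLUB_image_average μ hα h hne hD h0 hT)

end Average

end QuasiInv

theorem lemma2p3 {A : Type*} [NonUnitalCStarAlgebra A] [PartialOrder A] [StarOrderedRing A]
    [TopologicalSpace.SeparableSpace A]
    {G : Type*} [Group G] [TopologicalSpace G] [IsTopologicalGroup G] [CompactSpace G]
    [MeasurableSpace G] [BorelSpace G]
    (μ : Measure G) [μ.IsHaarMeasure] [IsProbabilityMeasure μ]
    (α : G →* (A ≃⋆ₐ[ℂ] A)) (hα : ∀ a : A, Continuous fun g : G => α g a)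
    (ω : A →ₚ[ℂ] ℂ) (hω : QuasiInv.IsState ω) (h : QuasiInv.IsQuasiInvariant α ω) :
    (∀ (T : QuasiInv.gnsVN ω) (x : ω.GNS),
      Integrable (fun g : G => (QuasiInv.liftedAction h g T : ω.GNS →L[ℂ] ω.GNS) x) μ) ∧
    ∃ E : QuasiInv.gnsVN ω →ₗ[ℂ] QuasiInv.gnsVN ω,
      (∀ (T : QuasiInv.gnsVN ω) (x : ω.GNS), (E T : ω.GNS →L[ℂ] ω.GNS) x =
        ∫ g, (QuasiInv.liftedAction h g T : ω.GNS →L[ℂ] ω.GNS) x ∂μ) ∧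
      (∀ T : QuasiInv.gnsVN ω, E (star T * T) = 0 → T = 0) ∧
      (∀ φ : QuasiInv.gnsVN ω →ₗ[ℂ] ℂ, QuasiInv.IsNormalState (QuasiInv.gnsVN ω) φ →
        QuasiInv.IsNormalState (QuasiInv.gnsVN ω) (φ ∘ₗ E)) := by
  exact ⟨fun T x => QuasiInv.integrable_liftedAction μ hα h T x,
    QuasiInv.average μ hα h, QuasiInv.coe_average_apply μ hα h,
    fun _ hT => QuasiInv.eq_zero_of_average_star_mul_self_eq_zero μ hα h hT,
    fun _ hφ => hφ.comp_average μ hα h⟩
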